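/- For every $\varepsilon>0$ there is a constant $C_\varepsilon$ such that for every $n$ there is an integer $k\le C_\varepsilon\log^4 n$ for which the following holds. For every matroid $\mathcal M=(U,\mathcal I)$ with ground set $U$ of $n$ elements there is an online contention resolution scheme (OCRS) for $\mathcal M$ that uses $k$ samples and is $(\frac14-\varepsilon)$-selectable. Here, for $x\in[0,1]^U$, $R(x)\subseteq U$ is the random set that contains each $i\in U$ independently with probability $x_i$; its elements are called active. An OCRS that uses $k$ samples knows $\mathcal M$ but not $x$; its offline input consists of $k$ independent samples of $R(x)$, and it may use internal randomness. The elements of $U$ then arrive one by one in an order not known in advance, each revealing on arrival whether it belongs to the set $R(x)$ (which is independent of the samples and of the internal randomness). When an active element arrives, the scheme must decide irrevocably whether to include it in its output $A\subseteq R(x)$, on the basis of the samples, its internal randomness and the arrivals so far; always $A\in\mathcal I$. The scheme is $c$-selectable if for every $x$ in the matroid polytope $\mathcal P_{\mathcal M}=\mathrm{conv}\{\mathbf 1_I : I\in\mathcal I\}$ and every $i\in U$ with $x_i>0$, $$\Pr[\,i\in A \mid i\in R(x)\,]\ \ge\ c,$$ the probability being over $R(x)$, the samples and the internal randomness. This holds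 for every fixed order of arrival, and even against an almighty adversary, who determines the order of arrival with full knowledge of the realizations of all the randomness. -/

import Mathlib

open MeasureTheory ProbabilityTheory

noncomputable section

namespace OCRS

/-- The polytope `P_F ⊆ [0,1]^n` of a family `F` of feasible subsets of `{0, …, n-1}`: the convex
hull of the characteristic vectors of the feasible sets. -/
def polytope {n : ℕ} (F : Set (Set (Fin n))) : Set (Fin n → ℝ) :=
  convexHull ℝ {v | ∃ I ∈ F, v = I.indicator 1}

/-- The law of the random active set `R(x)`, as an indicator `Fin n → Bool`: the element `i` is
active with probability `x i`, independently over `i`. -/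
def activeLaw {n : ℕ} (x : Fin n → unitInterval) : Measure (Fin n → Bool) :=
  Measure.pi fun i => bernoulliMeasure true false (x i)

/-- What has been seen before time `t` if the elements arrive in the order `σ 0, σ 1, …` and `R` is
the active set: the list of the earlier arrivals, each with its activity status. -/
def history {n : ℕ} (σ : Equiv.Perm (Fin n)) (R : Fin n → Bool) (t : Fin n) :
    List (Fin n × Bool) :=
  ((List.finRange n).take t).map fun s => (σ s, R (σ s))

/-- The set of accepted elements when the elements arrive in the order `σ 0, σ 1, …`, the active set
is `R`, and `accept h e` tells whether the element `e` is taken if it is active on arrival and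
`h` was seen before. -/
def output {n : ℕ} (accept : List (Fin n × Bool) → Fin n → Bool)
    (σ : Equiv.Perm (Fin n)) (R : Fin n → Bool) : Set (Fin n) :=
  {e | R e = true ∧ accept (history σ R (σ.symm e)) e = true}

/-- A (randomized) online contention resolution scheme for the feasible family `F` that uses `k`
samples. Its offline input consists of `k` sampled active sets only. When an active element
arrives, it is irrevocably accepted or rejected on the basis of the internal random seed, the
samples, and the earlier arrivals (decisions made earlier are functions of these). The accepted
set is always feasible. -/
structure Scheme {n : ℕ} (F : Set (Set (Fin n))) (k : ℕ) where
  /-- the values of the internal randomness -/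
  Seed : Type
  /-- the measurable sets of seeds -/
  seedSpace : MeasurableSpace Seed
  /-- the law of the internal randomness -/
  seedLaw : Measure Seed
  seedLaw_isProbabilityMeasure : IsProbabilityMeasure seedLaw
  /-- the decision rule: seed, samples, earlier arrivals, arriving (active) element -/
  accept : Seed → (Fin k → Fin n → Bool) → List (Fin n × Bool) → Fin n → Bool
  measurable_accept : ∀ S h e, Measurable fun ω => accept ω S h e
  feasible : ∀ ω S σ R, output (accept ω S) σ R ∈ F

attribute [instance] Scheme.seedSpace Scheme.seedLaw_isProbabilityMeasure

namespace Scheme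

variable {n : ℕ} {F : Set (Set (Fin n))} {k : ℕ}

/-- The realizations of all the randomness: seed, samples, and active set. -/
abbrev Outcome (A : Scheme F k) : Type :=
  A.Seed × (Fin k → Fin n → Bool) × (Fin n → Bool)

/-- The joint law of the seed, the `k` samples of `R(x)` and the active set `R(x)`, all
independent. -/
def law (A : Scheme F k) (x : Fin n → unitInterval) : Measure A.Outcome :=
  A.seedLaw.prod ((Measure.pi fun _ : Fin k => activeLaw x).prod (activeLaw x))

/-- The event that `i` is active. -/
def active (A : Scheme F k) (i : Fin n) : Set A.Outcome :=
  {o | o.2.2 i = true}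

/-- The event that `i` is accepted, when the order of arrival is `σ o` at the outcome `o`. -/
def accepted (A : Scheme F k) (σ : A.Outcome → Equiv.Perm (Fin n)) (i : Fin n) : Set A.Outcome :=
  {o | i ∈ output (A.accept o.1 o.2.1) (σ o) o.2.2}

/-- `c`-selectability: for every `x ∈ P_F`, every element that can be active is accepted with
conditional probability at least `c` given that it is active. The order of arrival is chosen by
an almighty adversary, who knows the realizations of all the randomness, hence all the decisions
that follow; a fixed order is the case of a constant function `σ`. The scheme knows neither `x`
nor the order in advance. -/
def IsSelectable (A : Scheme F k) (c : ℝ) : Prop :=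
  ∀ x : Fin n → unitInterval, (fun i => (x i : ℝ)) ∈ polytope F →
  ∀ σ : A.Outcome → Equiv.Perm (Fin n), (∀ τ, MeasurableSet (σ ⁻¹' {τ})) →
  ∀ i : Fin n, 0 < x i →
    c ≤ (cond (A.law x) (A.active i)).real (A.accepted σ i)

end Scheme

end OCRS

end

/-! The scheme keeps each element by a fair coin (the mask) and computes from the samples a
decreasing chain of sets `N_0 = U ⊇ N_1 ⊇ …`. An active kept element of `N_l \ N_{l+1}` is accepted
unless it is spanned by `N_{l+1}` and the earlier active kept elements of `N_l`. The output is
independent: order accepted elements from deep levels outwards, and by arrival within a level; none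
is spanned by its predecessors.

`N_{l+1}` is grown inside `N = N_l` from the empty set: each round adds to `S` the elements whose
estimated probability of being spanned by `S` and the thinned active set in `N` is at least `1/2 +
2δ`. Let `Q` be the thinned active set in `N`. The expected rank of `S ∪ Q` starts at no more than
`rank N / 2`, since `x` lies in the polytope and thinning halves it. With estimates accurate to `δ`,
it rises by at most `1/2 - δ` per unit of rank gained by `S`; but it is at least `rank S`. Hence `(1
+ 2δ) rank S ≤ rank N` (`rank_grow_le`) after any number of rounds, and logarithmically many levels
eliminate every element with `x_e > 0`.

Growth at each level stops at a uniformly random round. An element left out there has score below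
the threshold unless it would enter in the very next round, which is unlikely because it enters at
most once. So, with high probability, `e` drops out at a level where it is spanned with probability
at most `1/2 + 3δ` (`exists_level_of_accurate`). The span event ignores `e` itself, so `e` is kept,
and not spanned, with conditional probability at least `1/2 (1/2 - 3δ)`, whatever the order of
arrival.

Each pair of level and round has its own block of samples. The sets tested there depend only on
other blocks, so Hoeffding's inequality and a union bound give accuracy everywhere. -/

noncomputable section

namespace OCRS

/-! ### Matroid rank and spanning. -/

section Matroid

variable {α : Type*} (M : Matroid α)

/-- The rank of a set in a matroid on a finite type, as a real number. -/
def rank (X : Set α) : ℝ := ((M.eRk X).toNat : ℝ)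

lemma rank_closure (X : Set α) : rank M (M.closure X) = rank M X := by
  simp [rank]

variable [Finite α]

lemma eRk_ne_top (X : Set α) : M.eRk X ≠ ⊤ :=
  (M.isRkFinite_of_finite X.toFinite).eRk_lt_top.ne

lemma coe_toNat_eRk (X : Set α) : ((M.eRk X).toNat : ℕ∞) = M.eRk X :=
  ENat.natCast_toNat (eRk_ne_top M X)

lemma rank_mono {X Y : Set α} (h : X ⊆ Y) : rank M X ≤ rank M Y :=
  Nat.cast_le.2 (ENat.toNat_le_toNat (M.eRk_mono h) (eRk_ne_top M Y))

lemma rank_le_ncard (X : Set α) : rank M X ≤ X.ncard :=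
  Nat.cast_le.2 (ENat.toNat_le_toNat (M.eRk_le_encard X) X.toFinite.encard_lt_top.ne)

lemma _root_.Matroid.Indep.ncard_le_rank {M : Matroid α} {I X : Set α} (hI : M.Indep I)
    (h : I ⊆ X) : (I.ncard : ℝ) ≤ rank M X :=
  Nat.cast_le.2 (ENat.toNat_le_toNat (hI.encard_le_eRk_of_subset h) (eRk_ne_top M X))

lemma rank_union_le (X Y : Set α) : rank M (X ∪ Y) ≤ rank M X + Y.ncard := by
  have h := M.eRk_union_le_eRk_add_encard X Y
  rw [← coe_toNat_eRk, ← coe_toNat_eRk M X, ← Y.toFinite.cast_ncard_eq] at h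
  unfold rank
  exact_mod_cast h

variable {M}

/-- Extend a basis of `S` to one of `S'` and take the new elements; a new element in `S` would be
spanned by the old basis. -/
lemma exists_relative_basis (hE : M.E = Set.univ) {S S' : Set α} (h : S ⊆ S') :
    ∃ I ⊆ S' \ S, S' ⊆ M.closure (S ∪ I) ∧ (I.ncard : ℝ) = rank M S' - rank M S := by
  obtain ⟨J, hJ⟩ := M.exists_isBasis S (by simp [hE])
  obtain ⟨J', hJ', hJJ'⟩ := hJ.indep.subset_isBasis_of_subset (hJ.subset.trans h) (by simp [hE])
  have hrk : ∀ {J S : Set α}, M.IsBasis J S → rank M S = J.ncard := by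
    intro J S hJ
    simp [rank, ← hJ.encard_eq_eRk, Set.ncard]
  refine ⟨J' \ J, fun e he ↦ ⟨hJ'.subset he.1, fun heS ↦ ?_⟩, ?_, ?_⟩
  · have h1 := hJ'.indep.notMem_closure_sdiff_of_mem he.1
    refine h1 (M.closure_subset_closure (X := J) ?_ (hJ.subset_closure heS))
    exact fun f hf ↦ ⟨hJJ' hf, fun hfe ↦ he.2 (Set.mem_singleton_iff.1 hfe ▸ hf)⟩
  · refine hJ'.subset_closure.trans (M.closure_subset_closure fun f hf ↦ ?_)
    by_cases hfJ : f ∈ J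
    · exact Or.inl (hJ.subset hfJ)
    · exact Or.inr ⟨hf, hfJ⟩
  · rw [hrk hJ, hrk hJ', ← Set.ncard_sdiff_add_ncard_of_subset hJJ']
    simp

-- Only those elements of `I` not yet spanned by `S ∪ Q` can raise the rank, each by at most one.
open Classical in
lemma rank_union_le_of_subset_closure (hE : M.E = Set.univ) {S S' : Set α} {I : Finset α}
    (h : S' ⊆ M.closure (S ∪ I)) (Q : Set α) :
    rank M (S' ∪ Q) ≤ rank M (S ∪ Q) + ∑ e ∈ I, if e ∈ M.closure (S ∪ Q) then (0 : ℝ) else 1 := by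
  set J : Set α := {e | e ∈ I ∧ e ∉ M.closure (S ∪ Q)}
  have hsub : S ∪ Q ⊆ M.closure (S ∪ Q ∪ J) :=
    (M.subset_closure (S ∪ Q) (by simp [hE])).trans (M.closure_subset_closure Set.subset_union_left)
  have hI : (I : Set α) ⊆ M.closure (S ∪ Q ∪ J) := by
    intro e he
    by_cases h' : e ∈ M.closure (S ∪ Q)
    · exact M.closure_subset_closure Set.subset_union_left h'
    · exact M.mem_closure_of_mem (Or.inr ⟨he, h'⟩) (by simp [hE])
  have hS' : S' ∪ Q ⊆ M.closure (S ∪ Q ∪ J) := by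
    refine Set.union_subset (h.trans ?_) (Set.subset_union_right.trans hsub)
    exact M.closure_subset_closure_of_subset_closure
      (Set.union_subset (Set.subset_union_left.trans hsub) hI)
  calc rank M (S' ∪ Q) ≤ rank M (S ∪ Q ∪ J) := by
        rw [← rank_closure M (S ∪ Q ∪ J)]; exact rank_mono M hS'
    _ ≤ rank M (S ∪ Q) + J.ncard := rank_union_le M _ _
    _ = _ := by
        have : J = ((I.filter fun e ↦ e ∉ M.closure (S ∪ Q) : Finset α) : Set α) := by
          ext; simp [J]
        rw [this, Set.ncard_coe_finset, Finset.card_filter]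
        simp only [ite_not, Nat.cast_sum, Nat.cast_ite, Nat.cast_zero, Nat.cast_one]

/-- A set is independent if no element is spanned by those of smaller key. -/
lemma indep_of_forall_notMem_closure {κ : Type*} [LinearOrder κ] (hE : M.E = Set.univ)
    {key : α → κ} (A : Set α)
    (h : ∀ e ∈ A, e ∉ M.closure {f ∈ A | f ≠ e ∧ key f ≤ key e}) : M.Indep A := by
  classical
  obtain ⟨A, rfl⟩ := A.toFinite.exists_finset_coe
  -- With the largest key inserted last, the hypothesis on the new element compares it with all the
  -- others.
  induction A using Finset.induction_on_max_value key with
  | empty => simp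
  | insert a s has hmax ih =>
    have hs : M.Indep (s : Set α) := by
      refine ih fun e he h' ↦ h e (by simp_all) (M.closure_subset_closure ?_ h')
      exact fun f hf ↦ ⟨by simpa using Or.inr hf.1, hf.2⟩
    rw [Finset.coe_insert, hs.insert_indep_iff_of_notMem (by simpa using has)]
    refine ⟨by simp [hE], fun h' ↦ h a (by simp) (M.closure_subset_closure (fun f hf ↦ ?_) h')⟩
    exact ⟨by simpa using Or.inr hf, fun hfa ↦ has (hfa ▸ hf), hmax f hf⟩

end Matroid

/-- The constraint is linear, so it suffices to check it on indicators of independent sets. -/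
lemma sum_le_rank_of_mem_polytope {n : ℕ} {M : Matroid (Fin n)} {x : Fin n → ℝ}
    (hx : x ∈ polytope {I | M.Indep I}) (N : Finset (Fin n)) :
    ∑ i ∈ N, x i ≤ rank M N := by
  classical
  have hconv : Convex ℝ {x : Fin n → ℝ | ∑ i ∈ N, x i ≤ rank M N} := by
    intro x hx y hy a b ha hb hab
    simp only [Set.mem_ofPred_eq, Pi.add_apply, Pi.smul_apply, smul_eq_mul, Finset.sum_add_distrib,
      ← Finset.mul_sum] at *
    calc _ ≤ a * rank M N + b * rank M N :=
          add_le_add (mul_le_mul_of_nonneg_left hx ha) (mul_le_mul_of_nonneg_left hy hb)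
      _ = rank M N := by rw [← add_mul, hab, one_mul]
  refine convexHull_min ?_ hconv hx
  rintro _ ⟨I, hI, rfl⟩
  have : ∑ i ∈ N, I.indicator (1 : Fin n → ℝ) i = ((I ∩ N : Set (Fin n)).ncard : ℝ) := by
    simp only [Set.indicator_apply, Pi.one_apply, ← Finset.sum_filter, Finset.sum_const,
      nsmul_eq_mul, mul_one]
    rw [← Set.ncard_coe_finset]
    congr 2
    ext; simp [and_comm]
  simp only [Set.mem_ofPred_eq, this]
  exact (hI.subset Set.inter_subset_left).ncard_le_rank Set.inter_subset_right

/-! ### Independence by resampling coordinates. -/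

section Resample

variable {ι : Type*} [Fintype ι] {X : ι → Type*} [∀ i, MeasurableSpace (X i)]
  (μ : ∀ i, Measure (X i)) [∀ i, IsProbabilityMeasure (μ i)]

open Classical in
/-- Replacing a block of coordinates by an independent copy preserves a product measure. -/
lemma measurePreserving_piecewise (B : Set ι) :
    MeasurePreserving (fun p : (∀ i, X i) × (∀ i, X i) ↦ B.piecewise p.2 p.1)
      ((Measure.pi μ).prod (Measure.pi μ)) (Measure.pi μ) := by
  have hm : Measurable fun p : (∀ i, X i) × (∀ i, X i) ↦ B.piecewise p.2 p.1 := by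
    refine measurable_pi_lambda _ fun i ↦ ?_
    by_cases hi : i ∈ B
    · simpa [hi] using measurable_snd.eval (a := i)
    · simpa [hi] using measurable_fst.eval (a := i)
  refine ⟨hm, (Measure.pi_eq fun s hs ↦ ?_).symm⟩
  rw [Measure.map_apply hm (MeasurableSet.univ_pi hs)]
  have : (fun p : (∀ i, X i) × (∀ i, X i) ↦ B.piecewise p.2 p.1) ⁻¹' Set.univ.pi s =
      (Set.univ.pi fun i ↦ if i ∈ B then Set.univ else s i) ×ˢ
        (Set.univ.pi fun i ↦ if i ∈ B then s i else Set.univ) := by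
    ext p
    simp only [Set.mem_preimage, Set.mem_pi, Set.mem_univ, true_implies, Set.mem_prod,
      ← forall_and]
    refine forall_congr' fun i ↦ ?_
    by_cases hi : i ∈ B <;> simp [hi]
  rw [this, Measure.prod_prod, Measure.pi_pi, Measure.pi_pi, ← Finset.prod_mul_distrib]
  refine Finset.prod_congr rfl fun i _ ↦ ?_
  by_cases hi : i ∈ B <;> simp [hi]

variable [∀ i, Finite (X i)] [∀ i, MeasurableSingletonClass (X i)]

open Classical in
/-- If a state does not depend on a block of coordinates, and, for each value of the state, a bad
event that depends on that block only is unlikely, then the bad event is unlikely at the random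
state. -/
lemma measureReal_bad_le {St : Type*} (B : Set ι) (state : (∀ i, X i) → St)
    (bad : St → Set (∀ i, X i)) {β : ℝ}
    (hstate : ∀ ω ω', (∀ i ∉ B, ω i = ω' i) → state ω = state ω')
    (hbad : ∀ s ω ω', (∀ i ∈ B, ω i = ω' i) → ω ∈ bad s → ω' ∈ bad s)
    (h : ∀ s, (Measure.pi μ).real (bad s) ≤ β) :
    (Measure.pi μ).real {ω | ω ∈ bad (state ω)} ≤ β := by
  obtain ⟨ω₀⟩ := (Measure.pi μ).nonempty_of_neZero
  have hβ : 0 ≤ β := measureReal_nonneg.trans (h (state ω₀))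
  refine ENNReal.toReal_le_of_le_ofReal hβ ?_
  rw [← (measurePreserving_piecewise μ B).measure_preimage
    (Set.toFinite _).measurableSet.nullMeasurableSet, Measure.prod_apply .of_discrete]
  refine (lintegral_mono (g := fun _ ↦ ENNReal.ofReal β) fun ω ↦ ?_).trans (by simp)
  refine le_trans (measure_mono (t := bad (state ω)) fun ω' hω' ↦ ?_)
    ((ENNReal.le_ofReal_iff_toReal_le (measure_ne_top _ _) hβ).2 (h _))
  simp only [Set.mem_preimage, Set.mem_ofPred_eq] at hω'
  rw [hstate _ ω fun i hi ↦ by simp [hi]] at hω'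
  exact hbad _ _ _ (fun i hi ↦ by simp [hi]) hω'

/-- A coordinate is independent of an event that does not depend on it. -/
lemma pi_inter_coordinate (i : ι) (s : Set (X i)) (Q : Set (∀ i, X i))
    (hQ : ∀ ω ω', (∀ j ≠ i, ω j = ω' j) → ω ∈ Q → ω' ∈ Q) :
    Measure.pi μ {ω | ω i ∈ s ∧ ω ∈ Q} = μ i s * Measure.pi μ Q := by
  classical
  obtain ⟨B, hB⟩ : ∃ B : Set ι, B = {i} := ⟨_, rfl⟩
  rw [← (measurePreserving_piecewise μ B).measure_preimage
    (Set.toFinite _).measurableSet.nullMeasurableSet]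
  have : (fun p : (∀ i, X i) × (∀ i, X i) ↦ B.piecewise p.2 p.1) ⁻¹'
      {ω | ω i ∈ s ∧ ω ∈ Q} = Q ×ˢ ((fun ω ↦ ω i) ⁻¹' s) := by
    ext p
    simp only [Set.mem_preimage, Set.mem_ofPred_eq, Set.mem_prod]
    rw [and_comm]
    refine and_congr ⟨hQ _ _ ?_, hQ _ _ ?_⟩ (by simp [hB]) <;> intro j hj <;> simp [hB, hj]
  rw [this, Measure.prod_prod, (measurePreserving_eval μ i).measure_preimage
    (Set.toFinite s).measurableSet.nullMeasurableSet, mul_comm]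

end Resample

/-! ### Concentration of sample means. -/

section Hoeffding

variable {ι Ω : Type*} [Fintype ι] [MeasurableSpace Ω] (μ : Measure Ω) [IsProbabilityMeasure μ]

lemma hoeffding_upper {g : Ω → ℝ} (hg : Measurable g) (h01 : ∀ a, g a ∈ Set.Icc 0 1)
    (B : Finset ι) {δ : ℝ} (hδ : 0 ≤ δ) :
    (Measure.pi fun _ : ι ↦ μ).real {ω | B.card * δ ≤ ∑ j ∈ B, (g (ω j) - ∫ a, g a ∂μ)} ≤
      Real.exp (-(2 * δ ^ 2 * B.card)) := by
  have hind : iIndepFun (fun (j : ι) (ω : ι → Ω) ↦ g (ω j) - ∫ a, g a ∂μ)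
      (Measure.pi fun _ : ι ↦ μ) :=
    iIndepFun_pi (μ := fun _ : ι ↦ μ) (X := fun _ a ↦ g a - ∫ a, g a ∂μ)
      fun _ ↦ (hg.sub_const _).aemeasurable
  have hint : ∀ j : ι, ∫ ω : ι → Ω, g (ω j) ∂(Measure.pi fun _ : ι ↦ μ) = ∫ a, g a ∂μ := fun j ↦
    integral_comp_eval (μ := fun _ : ι ↦ μ) hg.aestronglyMeasurable
  have hsub : ∀ j ∈ B, HasSubgaussianMGF (fun (ω : ι → Ω) ↦ g (ω j) - ∫ a, g a ∂μ)
      ((‖(1 : ℝ) - 0‖₊ / 2) ^ 2) (Measure.pi fun _ : ι ↦ μ) := fun j _ ↦ by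
    rw [← hint j]
    exact hasSubgaussianMGF_of_mem_Icc (hg.comp (measurable_pi_apply j)).aemeasurable
      (ae_of_all _ fun ω ↦ h01 _)
  refine (HasSubgaussianMGF.measure_sum_ge_le_of_iIndepFun hind hsub (by positivity)).trans ?_
  rcases B.eq_empty_or_nonempty with rfl | hB
  · simp
  have : (B.card : ℝ) ≠ 0 := by simpa using hB.ne_empty
  refine Real.exp_le_exp.2 (le_of_eq ?_)
  simp
  field_simp

lemma hoeffding_mean {g : Ω → ℝ} (hg : Measurable g) (h01 : ∀ a, g a ∈ Set.Icc 0 1)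
    {B : Finset ι} (hB : B.Nonempty) {δ : ℝ} (hδ : 0 ≤ δ) :
    (Measure.pi fun _ : ι ↦ μ).real {ω | δ ≤ |(∑ j ∈ B, g (ω j)) / B.card - ∫ a, g a ∂μ|} ≤
      2 * Real.exp (-(2 * δ ^ 2 * B.card)) := by
  have hc : (0 : ℝ) < B.card := by simpa using hB
  have hgi : Integrable g μ := .of_mem_Icc 0 1 hg.aemeasurable (ae_of_all _ h01)
  have h1 := hoeffding_upper μ hg h01 B hδ
  -- The lower tail of `g` is the upper tail of `1 - g`.
  have h2 := hoeffding_upper μ (g := fun a ↦ 1 - g a) (hg.const_sub _)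
    (fun a ↦ ⟨by linarith [(h01 a).2], by linarith [(h01 a).1]⟩) B hδ
  rw [two_mul]
  refine (measureReal_mono fun ω hω ↦ ?_).trans
    ((measureReal_union_le _ _).trans (add_le_add h1 h2))
  simp only [Set.mem_ofPred_eq, Set.mem_union, integral_sub (integrable_const (1 : ℝ)) hgi,
    Finset.sum_sub_distrib, Finset.sum_const, nsmul_eq_mul, integral_const, probReal_univ,
    smul_eq_mul, mul_one] at hω ⊢
  have key : ∑ j ∈ B, g (ω j) = B.card * ((∑ j ∈ B, g (ω j)) / B.card) := by field_simp
  rcases le_abs.1 hω with h | h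
  · left
    rw [key]
    nlinarith
  · right
    rw [key]
    nlinarith

end Hoeffding

/-! ### Random stopping and expected rank growth. -/

/-- At a uniformly random time, a given element enters an increasing sequence of sets with
probability at most the inverse of the number of times. -/
lemma uniformOn_real_enter_le {α : Type*} (T : ℕ) {S : ℕ → Set α} (hS : Monotone S) (e : α) :
    (uniformOn (Set.univ : Set (Fin (T + 1)))).real {a | e ∈ S (a + 1) ∧ e ∉ S a} ≤
      1 / (T + 1) := by
  classical
  rw [Measure.real, uniformOn_univ, ENNReal.toReal_div]
  rw [Fintype.card_fin, ENNReal.toReal_natCast, Nat.cast_add, Nat.cast_one]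
  gcongr
  have hsub : {a : Fin (T + 1) | e ∈ S (a + 1) ∧ e ∉ S a}.Subsingleton := by
    intro a ha b hb
    by_contra hne
    rcases lt_or_gt_of_ne hne with h | h
    · exact hb.2 (hS (Nat.succ_le_of_lt h) ha.1)
    · exact ha.2 (hS (Nat.succ_le_of_lt h) hb.1)
  rw [Measure.count_apply (Set.toFinite _).measurableSet]
  have := Set.encard_le_one_iff_subsingleton.2 hsub
  exact ENNReal.toReal_mono (b := 1) (by simp) (by exact_mod_cast this)

section ExpectedRank

variable {α Ω : Type*} [Finite α] {M : Matroid α} [Finite Ω] [MeasurableSpace Ω]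
  [MeasurableSingletonClass Ω] (ν : Measure Ω) [IsProbabilityMeasure ν]

/-- Each element of a basis of `S'` relative to `S` contributes only when `Q` fails to help span it,
which has probability at most `1 - q`. -/
lemma integral_rank_union_le (hE : M.E = Set.univ) (Q : Ω → Set α) {S S' : Set α} (h : S ⊆ S')
    {q : ℝ} (hq : ∀ e ∈ S' \ S, q ≤ ν.real {ω | e ∈ M.closure (S ∪ Q ω)}) :
    ∫ ω, rank M (S' ∪ Q ω) ∂ν ≤
      ∫ ω, rank M (S ∪ Q ω) ∂ν + (1 - q) * (rank M S' - rank M S) := by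
  classical
  obtain ⟨I, hI, hcl, hcard⟩ := exists_relative_basis hE h
  obtain ⟨I, rfl⟩ := I.toFinite.exists_finset_coe
  rw [Set.ncard_coe_finset] at hcard
  have hterm : ∀ e ∈ I,
      ∫ ω, (if e ∈ M.closure (S ∪ Q ω) then (0 : ℝ) else 1) ∂ν ≤ 1 - q := by
    intro e he
    have : (fun ω ↦ if e ∈ M.closure (S ∪ Q ω) then (0 : ℝ) else 1) =
        {ω | e ∈ M.closure (S ∪ Q ω)}ᶜ.indicator 1 := by
      ext ω; by_cases h : e ∈ M.closure (S ∪ Q ω) <;> simp [h]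
    rw [this, integral_indicator_one .of_discrete, probReal_compl_eq_one_sub .of_discrete]
    linarith [hq e (hI he)]
  calc ∫ ω, rank M (S' ∪ Q ω) ∂ν
      ≤ ∫ ω, (rank M (S ∪ Q ω) +
          ∑ e ∈ I, if e ∈ M.closure (S ∪ Q ω) then (0 : ℝ) else 1) ∂ν :=
        integral_mono .of_finite .of_finite fun ω ↦ rank_union_le_of_subset_closure hE hcl _
    _ = ∫ ω, rank M (S ∪ Q ω) ∂ν +
          ∑ e ∈ I, ∫ ω, (if e ∈ M.closure (S ∪ Q ω) then (0 : ℝ) else 1) ∂ν := by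
        rw [integral_add .of_finite .of_finite, integral_finsetSum _ fun _ _ ↦ .of_finite]
    _ ≤ _ := by
        rw [← hcard, mul_comm, ← nsmul_eq_mul]
        gcongr
        exact Finset.sum_le_card_nsmul _ _ _ hterm

end ExpectedRank

/-! ### Growing sets and chains. -/

section Grow

variable {α : Type*}

/-- The increasing sequence of sets which starts with the empty set, and to which, in round `r`,
the elements of `N` are added whose score reaches the threshold `θ`. -/
def grow (θ : ℝ) (N : Set α) (score : ℕ → Set α → α → ℝ) : ℕ → Set α
  | 0 => ∅
  | r + 1 => grow θ N score r ∪ {e ∈ N | θ ≤ score r (grow θ N score r) e}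

variable {θ : ℝ} {N : Set α} {score score' : ℕ → Set α → α → ℝ}

lemma grow_monotone : Monotone (grow θ N score) :=
  monotone_nat_of_le_succ fun _ ↦ Set.subset_union_left

lemma grow_subset : ∀ r, grow θ N score r ⊆ N
  | 0 => Set.empty_subset _
  | r + 1 => Set.union_subset (grow_subset r) (Set.sep_subset _ _)

/-- The set tested in round `r` reads only scores of earlier rounds, so the samples of round `r` are
fresh for it. -/
lemma grow_congr {r : ℕ} (h : ∀ s < r, score s = score' s) :
    grow θ N score r = grow θ N score' r := by
  induction r with
  | zero => rfl
  | succ r ih => rw [grow, grow, ih fun s hs ↦ h s (by omega), h r (by omega)]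

/-- The decreasing chain of sets which starts with the whole ground set; the successor of the
`l`-th set `N` is the set grown inside `N` after `t l` rounds. -/
def level (θ : ℝ) (score : ℕ → ℕ → Set α → Set α → α → ℝ) (t : ℕ → ℕ) : ℕ → Set α
  | 0 => Set.univ
  | l + 1 => grow θ (level θ score t l) (fun r ↦ score l r (level θ score t l)) (t l)

lemma level_antitone {score : ℕ → ℕ → Set α → Set α → α → ℝ} {t : ℕ → ℕ} :
    Antitone (level θ score t) :=
  antitone_nat_of_succ_le fun _ ↦ grow_subset _

lemma level_congr {score score' : ℕ → ℕ → Set α → Set α → α → ℝ} {t t' : ℕ → ℕ} {l : ℕ}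
    (h : ∀ i < l, score i = score' i) (ht : ∀ i < l, t i = t' i) :
    level θ score t l = level θ score' t' l := by
  induction l with
  | zero => rfl
  | succ l ih =>
    rw [level, level, ih (fun i hi ↦ h i (by omega)) (fun i hi ↦ ht i (by omega)),
      h l (by omega), ht l (by omega)]

end Grow

/-! ### Thinned active sets and the rank decrease. -/

variable {n : ℕ}

instance (x : Fin n → unitInterval) : IsProbabilityMeasure (activeLaw x) := by
  unfold activeLaw; infer_instance

/-- The constant vector `1/2`. -/
def half (n : ℕ) : Fin n → unitInterval := fun _ ↦ ⟨1 / 2, by norm_num, by norm_num⟩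

/-- The elements that are active and survive the thinning by a mask. -/
def thin (p : (Fin n → Bool) × (Fin n → Bool)) : Set (Fin n) := {i | p.1 i = true ∧ p.2 i = true}

/-- The joint law of a mask, which keeps each element with probability `1/2`, and the active set. -/
def thinLaw (x : Fin n → unitInterval) : Measure ((Fin n → Bool) × (Fin n → Bool)) :=
  (activeLaw (half n)).prod (activeLaw x)

instance (x : Fin n → unitInterval) : IsProbabilityMeasure (thinLaw x) := by
  unfold thinLaw; infer_instance

lemma bernoulli_true (p : unitInterval) :
    bernoulliMeasure true false p {true} = ENNReal.ofReal p := by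
  rw [bernoulliMeasure_apply_of_mem_of_notMem _ (by simp) (by simp) (by simp)]
  rw [ENNReal.ofReal, Real.toNNReal_of_nonneg p.2.1]
  rfl

/-- An element is kept and active with half its probability of being active, independently of the
other elements. -/
lemma thinLaw_coordinate (x : Fin n → unitInterval) (i : Fin n)
    (Q : Set ((Fin n → Bool) × (Fin n → Bool)))
    (hQ : ∀ p p' : (Fin n → Bool) × (Fin n → Bool),
      (∀ j ≠ i, p.1 j = p'.1 j ∧ p.2 j = p'.2 j) → p ∈ Q → p' ∈ Q) :
    (thinLaw x).real {p | p.1 i = true ∧ p.2 i = true ∧ p ∈ Q} =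
      1 / 2 * x i * (thinLaw x).real Q := by
  have h1 : thinLaw x {p | p.1 i = true ∧ p.2 i = true ∧ p ∈ Q} =
      ENNReal.ofReal (x i) * thinLaw x {p | p.1 i = true ∧ p ∈ Q} := by
    rw [thinLaw, Measure.prod_apply .of_discrete, Measure.prod_apply .of_discrete,
      ← lintegral_const_mul _ (Measurable.of_discrete)]
    refine lintegral_congr fun m ↦ ?_
    rw [← bernoulli_true]
    have := pi_inter_coordinate (fun i ↦ bernoulliMeasure true false (x i)) i {true}
      {R | m i = true ∧ (m, R) ∈ Q} fun R R' h hR ↦ ⟨hR.1, hQ (m, R) (m, R') (fun j hj ↦ ⟨rfl, h j hj⟩) hR.2⟩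
    refine Eq.trans (congrArg _ ?_) this
    ext R
    simp [and_left_comm]
  have h2 : thinLaw x {p | p.1 i = true ∧ p ∈ Q} = ENNReal.ofReal (1 / 2) * thinLaw x Q := by
    rw [thinLaw, Measure.prod_apply_symm .of_discrete, Measure.prod_apply_symm .of_discrete,
      ← lintegral_const_mul _ (Measurable.of_discrete)]
    refine lintegral_congr fun R ↦ ?_
    have := pi_inter_coordinate (fun i ↦ bernoulliMeasure true false (half n i)) i {true}
      {m | (m, R) ∈ Q} fun m m' h hm ↦ hQ (m, R) (m', R) (fun j hj ↦ ⟨h j hj, rfl⟩) hm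
    rw [bernoulli_true] at this
    exact this
  rw [Measure.real, h1, h2, ENNReal.toReal_mul, ENNReal.toReal_mul,
    ENNReal.toReal_ofReal (x i).2.1, ENNReal.toReal_ofReal (by norm_num), ← Measure.real]
  ring

/-- The expected number of kept and active elements in a set. -/
lemma integral_ncard_thin (x : Fin n → unitInterval) (N : Finset (Fin n)) :
    ∫ p, ((thin p ∩ N).ncard : ℝ) ∂(thinLaw x) = 1 / 2 * ∑ i ∈ N, (x i : ℝ) := by
  classical
  have hcard : ∀ p : (Fin n → Bool) × (Fin n → Bool),
      ((thin p ∩ N).ncard : ℝ) = ∑ i ∈ N, {p | i ∈ thin p}.indicator (fun _ ↦ (1 : ℝ)) p := by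
    intro p
    simp only [Set.indicator_apply, ← Finset.sum_filter, Finset.sum_const,
      nsmul_eq_mul, mul_one]
    rw [← Set.ncard_coe_finset]
    congr 2
    ext; simp [and_comm]
  simp_rw [hcard]
  rw [integral_finsetSum _ fun _ _ ↦ .of_finite, Finset.mul_sum]
  refine Finset.sum_congr rfl fun i _ ↦ ?_
  rw [integral_indicator_const _ .of_discrete]
  have := thinLaw_coordinate x i Set.univ fun _ _ _ _ ↦ trivial
  simpa [thin] using this

/-- The event that `e` is spanned by `S` and the thinned active set inside `N`, `e` itself left
out. -/
def spanEvent (M : Matroid (Fin n)) (N S : Set (Fin n)) (e : Fin n) :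
    Set ((Fin n → Bool) × (Fin n → Bool)) :=
  {p | e ∈ M.closure ((S ∪ thin p ∩ N) \ {e})}

/-- The probability, over the mask, of the span event for a given active set. -/
def maskSpanProb (M : Matroid (Fin n)) (N S : Set (Fin n)) (e : Fin n) (R : Fin n → Bool) : ℝ :=
  (activeLaw (half n)).real {m | (m, R) ∈ spanEvent M N S e}

/-- By Fubini, averaging the mask out exactly leaves an unbiased estimator that needs only samples
of `R(x)`. -/
lemma integral_maskSpanProb (M : Matroid (Fin n)) (N S : Set (Fin n)) (e : Fin n)
    (x : Fin n → unitInterval) :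
    ∫ R, maskSpanProb M N S e R ∂(activeLaw x) = (thinLaw x).real (spanEvent M N S e) := by
  rw [Measure.real, thinLaw, Measure.prod_apply_symm .of_discrete]
  exact integral_toReal Measurable.of_discrete.aemeasurable (ae_of_all _ fun _ ↦ measure_lt_top _ _)

/-- The expected rank of the grown set joined with the thinned active set is a potential: it starts
at no more than `rank M N / 2`, grows at rate at most `1/2 - δ`, and dominates the rank of the grown
set. -/
lemma rank_grow_le {M : Matroid (Fin n)} (hE : M.E = Set.univ) {x : Fin n → unitInterval}
    (hx : (fun i ↦ (x i : ℝ)) ∈ polytope {I | M.Indep I}) (N : Set (Fin n))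
    {score : ℕ → Set (Fin n) → Fin n → ℝ} {δ : ℝ} {r : ℕ}
    (h : ∀ s < r, ∀ e, |score s (grow (1 / 2 + 2 * δ) N score s) e -
      (thinLaw x).real (spanEvent M N (grow (1 / 2 + 2 * δ) N score s) e)| < δ) :
    (1 + 2 * δ) * rank M (grow (1 / 2 + 2 * δ) N score r) ≤ rank M N := by
  set S := grow (1 / 2 + 2 * δ) N score with hS
  have hstep : ∀ s ≤ r, ∫ p, rank M (S s ∪ thin p ∩ N) ∂(thinLaw x) ≤
      rank M N / 2 + (1 - (1 / 2 + δ)) * rank M (S s) := by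
    intro s hs
    induction s with
    | zero =>
      classical
      obtain ⟨N', rfl⟩ := N.toFinite.exists_finset_coe
      have h0 : rank M (S 0) = 0 := by simp [hS, grow, rank]
      rw [h0, mul_zero, add_zero]
      refine (integral_mono (g := fun p ↦ ((thin p ∩ N').ncard : ℝ)) .of_finite .of_finite
        fun p ↦ ?_).trans ?_
      · simpa [hS, grow] using rank_le_ncard M (thin p ∩ N')
      · rw [integral_ncard_thin]
        linarith [sum_le_rank_of_mem_polytope hx N']
    | succ s ih =>
      have := integral_rank_union_le (thinLaw x) hE (fun p ↦ thin p ∩ N)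
        (S := S s) (S' := S (s + 1)) (q := 1 / 2 + δ) (grow_monotone s.le_succ) ?_
      · linarith [ih (by omega)]
      -- An added element scores at least `1/2 + 2δ`, so its true span probability exceeds `1/2 +
      -- δ`.
      · rintro e ⟨he | he, he'⟩
        · exact absurd he he'
        · have h1 := abs_lt.1 (h s (by omega) e)
          have h2 : (thinLaw x).real (spanEvent M N (S s) e) ≤
              (thinLaw x).real {p | e ∈ M.closure (S s ∪ thin p ∩ N)} :=
            measureReal_mono fun p hp ↦ M.closure_subset_closure Set.sdiff_subset hp
          linarith [he.2]
  have hle : rank M (S r) ≤ ∫ p, rank M (S r ∪ thin p ∩ N) ∂(thinLaw x) := by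
    calc rank M (S r) = ∫ _, rank M (S r) ∂(thinLaw x) := by simp
      _ ≤ _ := integral_mono .of_finite .of_finite fun p ↦ rank_mono M Set.subset_union_left
  linarith [hstep r le_rfl]

lemma mem_history {σ : Equiv.Perm (Fin n)} {R : Fin n → Bool} {t f : Fin n} {b : Bool} :
    (f, b) ∈ history σ R t ↔ σ.symm f < t ∧ R f = b := by
  have hmem : ∀ s : Fin n, s ∈ (List.finRange n).take t ↔ s < t := by
    intro s
    rw [List.mem_take_iff_getElem]
    constructor
    · rintro ⟨i, hi, rfl⟩
      simp only [lt_inf_iff] at hi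
      simpa [Fin.lt_def] using hi.1
    · intro h
      exact ⟨s, by simp [h], by simp⟩
  simp only [history, List.mem_map, Prod.mk.injEq, hmem]
  constructor
  · rintro ⟨s, hs, rfl, rfl⟩
    simpa using hs
  · rintro ⟨h, rfl⟩
    exact ⟨σ.symm f, h, by simp, by simp⟩

/-! ### The acceptance rule along a chain. -/

section Rule

variable (M : Matroid (Fin n)) (C : ℕ → Set (Fin n)) (L : ℕ) (mask : Fin n → Bool)

open Classical in
/-- The acceptance rule for a chain of sets and a mask: an unmasked element is rejected, and an
element in the difference of two consecutive sets of the chain is accepted if it is not spanned by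
the smaller set and the earlier active and kept elements of the larger set. -/
def chainAccept (h : List (Fin n × Bool)) (e : Fin n) : Bool :=
  decide (mask e = true ∧ ∃ l < L, e ∈ C l ∧ e ∉ C (l + 1) ∧
    e ∉ M.closure (C (l + 1) ∪ {f ∈ C l | mask f = true ∧ (f, true) ∈ h}))

variable {M C L mask}

lemma indep_output_chainAccept (hE : M.E = Set.univ) (hC : Antitone C) (hC0 : C 0 = Set.univ)
    (σ : Equiv.Perm (Fin n)) (R : Fin n → Bool) :
    M.Indep (output (chainAccept M C L mask) σ R) := by
  classical
  -- Its cardinality is larger the earlier an element leaves the chain, so deeper elements come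
  -- first and ties are broken by arrival.
  set height : Fin n → Finset ℕ := fun e ↦ (Finset.range L).filter fun l ↦ e ∉ C (l + 1)
  refine indep_of_forall_notMem_closure hE
    (key := fun e ↦ toLex ((height e).card, σ.symm e)) _ fun e he hcl ↦ ?_
  obtain ⟨-, he⟩ := he
  simp only [chainAccept, decide_eq_true_eq] at he
  obtain ⟨-, l, hl, hel, hel', hspan⟩ := he
  refine hspan (M.closure_subset_closure ?_ hcl)
  rintro f ⟨⟨hfR, hf⟩, hfe, hkey⟩
  simp only [chainAccept, decide_eq_true_eq] at hf
  have hsub : f ∉ C (l + 1) → height e ⊆ height f := by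
    intro hfl i hi
    simp only [height, Finset.mem_filter, Finset.mem_range] at hi ⊢
    refine ⟨hi.1, fun hfi ↦ ?_⟩
    rcases lt_or_ge i l with h | h
    · exact hi.2 (hC h hel)
    · exact hfl (hC (by omega) hfi)
  by_cases hfl : f ∈ C (l + 1)
  · exact Or.inl hfl
  have hcard := Finset.card_le_card (hsub hfl)
  rw [Prod.Lex.toLex_le_toLex] at hkey
  obtain hkey | ⟨hkey, htime⟩ := hkey
  · exact absurd hkey (by simpa using hcard)
  have heq := Finset.eq_of_subset_of_card_le (hsub hfl) hkey.le
  refine Or.inr ⟨?_, hf.1, mem_history.2 ⟨?_, hfR⟩⟩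
  · by_contra hfl'
    obtain _ | l := l
    · exact hfl' (hC0 ▸ Set.mem_univ f)
    · have : l ∈ height f := by
        simp only [height, Finset.mem_filter, Finset.mem_range]
        exact ⟨by omega, hfl'⟩
      rw [← heq] at this
      simp only [height, Finset.mem_filter] at this
      exact this.2 hel
  · exact lt_of_le_of_ne htime fun h ↦ hfe (σ.symm.injective h)

/-- The earlier arrivals are only part of the active set, so an element not spanned even by all of
it is safe under every order; this defeats the almighty adversary. -/
lemma mem_output_chainAccept {l : ℕ} (hl : l < L) {e : Fin n} (he : e ∈ C l) (he' : e ∉ C (l + 1))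
    {R : Fin n → Bool} (hm : mask e = true) (hR : R e = true)
    (hspan : (mask, R) ∉ spanEvent M (C l) (C (l + 1)) e) (σ : Equiv.Perm (Fin n)) :
    e ∈ output (chainAccept M C L mask) σ R := by
  refine ⟨hR, ?_⟩
  simp only [chainAccept, decide_eq_true_eq]
  refine ⟨hm, l, hl, he, he', fun h ↦ hspan (M.closure_subset_closure ?_ h)⟩
  rintro f (hf | ⟨hf, hmf, hfh⟩)
  · exact ⟨Or.inl hf, fun hfe ↦ he' (Set.mem_singleton_iff.1 hfe ▸ hf)⟩
  · rw [mem_history] at hfh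
    refine ⟨Or.inr ⟨⟨hmf, hfh.2⟩, hf⟩, fun hfe ↦ ?_⟩
    rw [Set.mem_singleton_iff.1 hfe] at hfh
    exact lt_irrefl _ hfh.1

end Rule

/-! ### The chain computed from samples. -/

section Chain

variable (M : Matroid (Fin n)) (δ : ℝ) (T m : ℕ) {L k : ℕ}

/-- The samples reserved for round `r` at level `l`. -/
def block (k T m l r : ℕ) : Finset (Fin k) :=
  Finset.univ.filter fun j ↦ (j : ℕ) / m / T = l ∧ (j : ℕ) / m % T = r

/-- The estimate of the span probability from the samples of one block. -/
def sampleScore (ω : Fin k → Fin n → Bool) (l r : ℕ) (N S : Set (Fin n)) (e : Fin n) : ℝ :=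
  (∑ j ∈ block k (T + 1) m l r, maskSpanProb M N S e (ω j)) / (block k (T + 1) m l r).card

/-- The stopping times as a function on the natural numbers. -/
def growTime {T : ℕ} (t : Fin L → Fin (T + 1)) (l : ℕ) : ℕ :=
  if h : l < L then t ⟨l, h⟩ else 0

/-- The chain computed from the samples and the stopping times. -/
def chain (t : Fin L → Fin (T + 1)) (ω : Fin k → Fin n → Bool) : ℕ → Set (Fin n) :=
  level (1 / 2 + 2 * δ) (sampleScore M T m ω) (growTime t)

/-- The set grown inside the `l`-th set of the chain after `r` rounds. -/
def stage (t : Fin L → Fin (T + 1)) (ω : Fin k → Fin n → Bool) (l : ℕ) : ℕ → Set (Fin n) :=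
  grow (1 / 2 + 2 * δ) (chain M δ T m t ω l)
    fun r ↦ sampleScore M T m ω l r (chain M δ T m t ω l)

lemma chain_succ (t : Fin L → Fin (T + 1)) (ω : Fin k → Fin n → Bool) (l : ℕ) :
    chain M δ T m t ω (l + 1) = stage M δ T m t ω l (growTime t l) := rfl

lemma card_block {T m l r : ℕ} (hm : 0 < m) (hl : l < L) (hr : r < T) :
    (block (L * T * m) T m l r).card = m := by
  have hq : l * T + r + 1 ≤ L * T := by nlinarith
  have : (block (L * T * m) T m l r).map Fin.valEmbedding =
      Finset.Ico ((l * T + r) * m) ((l * T + r) * m + m) := by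
    ext j
    simp only [block, Finset.mem_map, Finset.mem_filter, Finset.mem_univ, true_and,
      Fin.valEmbedding_apply, Finset.mem_Ico]
    have hT : 0 < T := by omega
    constructor
    · rintro ⟨j, ⟨h1, h2⟩, rfl⟩
      have h3 : (j : ℕ) / m = l * T + r := by
        rw [← h1, ← h2]; exact (Nat.div_add_mod' _ _).symm
      rw [← h3]
      have h4 := Nat.div_add_mod j m
      have h5 := Nat.mod_lt j hm
      rw [mul_comm] at h4
      omega
    · rintro ⟨h1, h2⟩
      have h3 : j / m = l * T + r := by
        refine Nat.div_eq_of_lt_le h1 ?_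
        rw [add_mul, one_mul]; exact h2
      have hj : j < L * T * m := by nlinarith
      refine ⟨⟨j, hj⟩, ⟨?_, ?_⟩, rfl⟩
      · simp only [h3]
        rw [mul_comm, Nat.mul_add_div hT, Nat.div_eq_of_lt hr, add_zero]
      · simp only [h3]
        rw [mul_comm, Nat.mul_add_mod, Nat.mod_eq_of_lt hr]
  rw [← Finset.card_map Fin.valEmbedding, this, Nat.card_Ico]
  omega

variable {M δ T m}

lemma sampleScore_congr {ω ω' : Fin k → Fin n → Bool} {l r : ℕ}
    (h : ∀ j ∈ block k (T + 1) m l r, ω j = ω' j) :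
    sampleScore M T m ω l r = sampleScore M T m ω' l r := by
  funext N S e
  unfold sampleScore
  rw [Finset.sum_congr rfl fun j hj ↦ by rw [h j hj]]

/-- Blocks are disjoint, and both sets read only blocks of earlier levels, or of earlier rounds at
level `l`. -/
lemma chain_stage_congr_samples {t : Fin L → Fin (T + 1)} {ω ω' : Fin k → Fin n → Bool} {l r : ℕ}
    (h : ∀ j ∉ block k (T + 1) m l r, ω j = ω' j) :
    chain M δ T m t ω l = chain M δ T m t ω' l ∧
      stage M δ T m t ω l r = stage M δ T m t ω' l r := by
  have hscore : ∀ i s, (i, s) ≠ (l, r) → sampleScore M T m ω i s = sampleScore M T m ω' i s := by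
    refine fun i s hne ↦ sampleScore_congr fun j hj ↦ h j fun hj' ↦ hne ?_
    simp only [block, Finset.mem_filter, Finset.mem_univ, true_and] at hj hj'
    rw [← hj.1, ← hj.2, ← hj'.1, ← hj'.2]
  have hchain : chain M δ T m t ω l = chain M δ T m t ω' l :=
    level_congr (fun i hi ↦ funext fun s ↦ hscore i s (by simp; omega)) fun _ _ ↦ rfl
  refine ⟨hchain, ?_⟩
  unfold stage
  rw [← hchain]
  exact grow_congr fun s hs ↦ by rw [hscore l s (by simp; omega)]

lemma stage_congr_growTime {t t' : Fin L → Fin (T + 1)} {ω : Fin k → Fin n → Bool} {l : Fin L}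
    (h : ∀ i ≠ l, t i = t' i) : stage M δ T m t ω l = stage M δ T m t' ω l := by
  have : chain M δ T m t ω l = chain M δ T m t' ω l :=
    level_congr (fun _ _ ↦ rfl) fun i hi ↦ by
      unfold growTime
      rw [dif_pos (hi.trans l.2), dif_pos (hi.trans l.2), h _ (by simp [Fin.ext_iff]; omega)]
  unfold stage
  rw [this]

lemma growTime_le (t : Fin L → Fin (T + 1)) (l : ℕ) : growTime t l ≤ T := by
  unfold growTime
  split_ifs <;> omega

/-- If all estimates are accurate, then an element that can be active and does not enter a stage
right after the stopping time lies in a difference of consecutive sets of the chain in which it is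
spanned with probability little more than `1/2`. -/
lemma exists_level_of_accurate (hE : M.E = Set.univ) {x : Fin n → unitInterval}
    (hx : (fun i ↦ (x i : ℝ)) ∈ polytope {I | M.Indep I}) (hδ : 0 < δ)
    (hL : n < (1 + 2 * δ) ^ L) {t : Fin L → Fin (T + 1)} {ω : Fin k → Fin n → Bool} {e : Fin n}
    (he : 0 < x e)
    (hacc : ∀ l < L, ∀ r ≤ T, ∀ f,
      |sampleScore M T m ω l r (chain M δ T m t ω l) (stage M δ T m t ω l r) f -
        (thinLaw x).real (spanEvent M (chain M δ T m t ω l) (stage M δ T m t ω l r) f)| < δ)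
    (hlate : ∀ l < L, ¬ (e ∈ stage M δ T m t ω l (growTime t l + 1) ∧
      e ∉ stage M δ T m t ω l (growTime t l))) :
    ∃ l < L, e ∈ chain M δ T m t ω l ∧ e ∉ chain M δ T m t ω (l + 1) ∧
      (thinLaw x).real (spanEvent M (chain M δ T m t ω l) (chain M δ T m t ω (l + 1)) e) ≤
        1 / 2 + 3 * δ := by
  have hrank : ∀ l ≤ L, (1 + 2 * δ) ^ l * rank M (chain M δ T m t ω l) ≤ n := by
    intro l hl
    induction l with
    | zero =>
      rw [pow_zero, one_mul]
      exact (rank_le_ncard M _).trans (by exact_mod_cast (Set.ncard_le_card _).trans (by simp))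
    | succ l ih =>
      refine le_trans ?_ (ih (by omega))
      rw [pow_succ, mul_assoc]
      refine mul_le_mul_of_nonneg_left ?_ (by positivity)
      exact rank_grow_le hE hx _ fun s hs f ↦
        hacc l (by omega) s (hs.le.trans (growTime_le t l)) f
  have heL : e ∉ chain M δ T m t ω L := by
    intro heL
    -- Positivity of `x e` makes `e` a non-loop, so a set containing it has rank at least `1`; the
    -- rank bound at level `L` is below `1`.
    have h1 : (0 : ℝ) < rank M {e} := by
      have := sum_le_rank_of_mem_polytope hx {e}
      simp only [Finset.sum_singleton, Finset.coe_singleton] at this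
      exact lt_of_lt_of_le (by exact_mod_cast he) this
    have h2 : (1 : ℝ) ≤ rank M {e} := by
      unfold rank at h1 ⊢
      exact_mod_cast Nat.cast_pos.1 h1
    have h3 := h2.trans (rank_mono M (Set.singleton_subset_iff.2 heL))
    have h4 := hrank L le_rfl
    have h5 : (0 : ℝ) < (1 + 2 * δ) ^ L := by positivity
    nlinarith
  obtain ⟨l, hl, hel, hel'⟩ :
      ∃ l < L, e ∈ chain M δ T m t ω l ∧ e ∉ chain M δ T m t ω (l + 1) := by
    by_contra! hcon
    have : ∀ l ≤ L, e ∈ chain M δ T m t ω l := by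
      intro l hl
      induction l with
      | zero => exact Set.mem_univ e
      | succ l ih => exact hcon l (by omega) (ih (by omega))
    exact heL (this L le_rfl)
  refine ⟨l, hl, hel, hel', ?_⟩
  rw [chain_succ] at hel' ⊢
  have h1 : e ∉ stage M δ T m t ω l (growTime t l + 1) := fun h ↦ hlate l hl ⟨h, hel'⟩
  have h2 := (abs_lt.1 (hacc l hl _ (growTime_le t l) e)).1
  have h3 : sampleScore M T m ω l (growTime t l) (chain M δ T m t ω l)
      (stage M δ T m t ω l (growTime t l)) e < 1 / 2 + 2 * δ := by
    by_contra! h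
    exact h1 (Or.inr ⟨hel, h⟩)
  linarith

end Chain

/-! ### Estimates in product spaces. -/

section Product

variable {α β γ κ : Type*} [MeasurableSpace α] [MeasurableSpace β] [MeasurableSpace γ]
  [MeasurableSpace κ] [Finite α] [Finite β] [Finite γ] [Finite κ] [MeasurableSingletonClass α]
  [MeasurableSingletonClass β] [MeasurableSingletonClass γ] [MeasurableSingletonClass κ]
  (μ : Measure α) (ν : Measure β) (ρ : Measure γ) (τ : Measure κ)

/-- Used to regroup the randomness: stopping times with samples, which fix the chain, and mask with
active set. -/
lemma measurePreserving_prodProdProdComm [SFinite μ] [SFinite ν] [SFinite ρ] [SFinite τ] :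
    MeasurePreserving (Equiv.prodProdProdComm α β γ κ) ((μ.prod ν).prod (ρ.prod τ))
      ((μ.prod ρ).prod (ν.prod τ)) := by
  refine ⟨.of_discrete, Measure.ext_of_singleton fun ⟨⟨a, c⟩, ⟨b, d⟩⟩ ↦ ?_⟩
  have : Equiv.prodProdProdComm α β γ κ ⁻¹' {((a, c), (b, d))} = {((a, b), (c, d))} := by
    ext ⟨⟨a', b'⟩, ⟨c', d'⟩⟩
    simp [and_and_and_comm]
  rw [Measure.map_apply .of_discrete .of_discrete, this]
  simp only [← Set.singleton_prod_singleton, Measure.prod_prod]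
  ring

variable {μ ν} [IsProbabilityMeasure μ] [IsProbabilityMeasure ν]

lemma le_prod_real {E : Set (α × β)} {G : Set α} {c : ℝ}
    (h : ∀ a ∈ G, c ≤ ν.real (Prod.mk a ⁻¹' E)) : μ.real G * c ≤ (μ.prod ν).real E := by
  rw [← integral_indicator_one (s := E) .of_discrete, integral_prod _ .of_finite,
    ← smul_eq_mul, ← setIntegral_const, ← integral_indicator .of_discrete]
  refine integral_mono .of_finite .of_finite fun a ↦ ?_
  have : ∫ b, E.indicator (1 : α × β → ℝ) (a, b) ∂ν = ν.real (Prod.mk a ⁻¹' E) := by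
    rw [← integral_indicator_one .of_discrete]; rfl
  simp only [this]
  by_cases ha : a ∈ G
  · simpa [ha] using h a ha
  · simp [ha]

lemma prod_real_le {E : Set (α × β)} {c : ℝ} (h : ∀ a, ν.real (Prod.mk a ⁻¹' E) ≤ c) :
    (μ.prod ν).real E ≤ c := by
  have := le_prod_real (μ := μ) (ν := ν) (E := Eᶜ) (G := Set.univ) (c := 1 - c) fun a _ ↦ by
    rw [Set.preimage_compl, probReal_compl_eq_one_sub .of_discrete]
    linarith [h a]
  rw [probReal_compl_eq_one_sub .of_discrete, probReal_univ] at this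
  linarith

lemma prod_real_le_symm {E : Set (α × β)} {c : ℝ}
    (h : ∀ b, μ.real ((fun a ↦ (a, b)) ⁻¹' E) ≤ c) : (μ.prod ν).real E ≤ c := by
  have := prod_real_le (μ := ν) (ν := μ) (E := Prod.swap ⁻¹' E) h
  rwa [Measure.real, (Measure.measurePreserving_swap).measure_preimage
    (Set.toFinite _).measurableSet.nullMeasurableSet] at this

end Product

instance (T : ℕ) : IsProbabilityMeasure (uniformOn (Set.univ : Set (Fin (T + 1)))) :=
  isProbabilityMeasure_uniformOn Set.finite_univ Set.univ_nonempty

/-- The law of independent uniformly distributed stopping times. -/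
def timeLaw (L T : ℕ) : Measure (Fin L → Fin (T + 1)) :=
  Measure.pi fun _ ↦ uniformOn Set.univ

instance (L T : ℕ) : IsProbabilityMeasure (timeLaw L T) := by
  unfold timeLaw; infer_instance

/-- The contention resolution scheme that accepts elements along the chain computed from the
samples. -/
def chainScheme (M : Matroid (Fin n)) (hE : M.E = Set.univ) (δ : ℝ) (L T m : ℕ) :
    Scheme {I | M.Indep I} (L * (T + 1) * m) where
  Seed := (Fin L → Fin (T + 1)) × (Fin n → Bool)
  seedSpace := inferInstance
  seedLaw := (timeLaw L T).prod (activeLaw (half n))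
  seedLaw_isProbabilityMeasure := inferInstance
  accept s ω := chainAccept M (chain M δ T m s.1 ω) L s.2
  measurable_accept _ _ _ := .of_discrete
  feasible _ _ σ R := indep_output_chainAccept hE level_antitone rfl σ R

/-! ### Failure probabilities of the offline phase. -/

section Estimates

variable {M : Matroid (Fin n)} {δ : ℝ} {L T m : ℕ} {x : Fin n → unitInterval}

/-- The law of the stopping times and the samples. -/
def offlineLaw (L T k : ℕ) (x : Fin n → unitInterval) :
    Measure ((Fin L → Fin (T + 1)) × (Fin k → Fin n → Bool)) :=
  (timeLaw L T).prod (Measure.pi fun _ ↦ activeLaw x)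

instance (L T k : ℕ) (x : Fin n → unitInterval) : IsProbabilityMeasure (offlineLaw L T k x) := by
  unfold offlineLaw; infer_instance

/-- The event that the estimate of the probability that `f` is spanned is inaccurate in round `r`
at level `l`. -/
def inaccurate (M : Matroid (Fin n)) (δ : ℝ) (L T m k : ℕ) (x : Fin n → unitInterval) (l r : ℕ)
    (f : Fin n) : Set ((Fin L → Fin (T + 1)) × (Fin k → Fin n → Bool)) :=
  {p | δ ≤ |sampleScore M T m p.2 l r (chain M δ T m p.1 p.2 l) (stage M δ T m p.1 p.2 l r) f -
    (thinLaw x).real (spanEvent M (chain M δ T m p.1 p.2 l) (stage M δ T m p.1 p.2 l r) f)|}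

/-- The event that `e` enters the set grown at level `l` right after the stopping time. -/
def late (M : Matroid (Fin n)) (δ : ℝ) (L T m k l : ℕ) (e : Fin n) :
    Set ((Fin L → Fin (T + 1)) × (Fin k → Fin n → Bool)) :=
  {p | e ∈ stage M δ T m p.1 p.2 l (growTime p.1 l + 1) ∧
    e ∉ stage M δ T m p.1 p.2 l (growTime p.1 l)}

lemma offlineLaw_inaccurate_le (hδ : 0 < δ) (hm : 0 < m) {l r : ℕ} (hl : l < L) (hr : r ≤ T)
    (f : Fin n) :
    (offlineLaw L T (L * (T + 1) * m) x).real (inaccurate M δ L T m _ x l r f) ≤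
      2 * Real.exp (-(2 * δ ^ 2 * m)) := by
  have hcard := card_block (T := T + 1) hm hl (Nat.lt_succ_of_le hr)
  refine prod_real_le fun t ↦ ?_
  refine measureReal_bad_le (fun _ ↦ activeLaw x) (block (L * (T + 1) * m) (T + 1) m l r)
    (fun ω ↦ (chain M δ T m t ω l, stage M δ T m t ω l r))
    (fun s ↦ {ω | δ ≤ |sampleScore M T m ω l r s.1 s.2 f -
      (thinLaw x).real (spanEvent M s.1 s.2 f)|}) (fun ω ω' h ↦ ?_) (fun s ω ω' h hω ↦ ?_)
    fun s ↦ ?_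
  · obtain ⟨h1, h2⟩ := chain_stage_congr_samples (M := M) (δ := δ) (t := t) (by simpa using h)
    rw [h1, h2]
  · rw [Set.mem_ofPred_eq] at hω ⊢
    rwa [← sampleScore_congr (by simpa using h)]
  · rw [← integral_maskSpanProb]
    have := hoeffding_mean (activeLaw x) (g := maskSpanProb M s.1 s.2 f) .of_discrete
      (fun _ ↦ ⟨measureReal_nonneg, measureReal_le_one⟩)
      (Finset.card_pos.1 (hcard.symm ▸ hm)) hδ.le
    simpa only [sampleScore, hcard] using this

/-- The whole sequence grown at level `l` is independent of the stopping time at that level. -/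
lemma offlineLaw_late_le (k : ℕ) {l : ℕ} (hl : l < L) (e : Fin n) :
    (offlineLaw L T k x).real (late M δ L T m k l e) ≤ 1 / (T + 1) := by
  refine prod_real_le_symm fun ω ↦ ?_
  have hval : ∀ t : Fin L → Fin (T + 1), growTime t l = t ⟨l, hl⟩ := fun t ↦ dif_pos hl
  simp only [late, Set.preimage_ofPred_eq, hval]
  refine measureReal_bad_le (fun _ ↦ uniformOn (Set.univ : Set (Fin (T + 1)))) {⟨l, hl⟩}
    (fun t ↦ (⟨stage M δ T m t ω l, grow_monotone⟩ : ℕ →o Set (Fin n)))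
    (fun S ↦ {t | e ∈ S (t ⟨l, hl⟩ + 1) ∧ e ∉ S (t ⟨l, hl⟩)}) (fun t t' h ↦ ?_)
    (fun S t t' h ht ↦ ?_) fun S ↦ ?_
  · ext1
    exact stage_congr_growTime (l := ⟨l, hl⟩) (by simpa using h)
  · rw [Set.mem_ofPred_eq] at ht ⊢
    rwa [← h _ rfl]
  · refine le_trans (le_of_eq ?_) (uniformOn_real_enter_le T S.monotone e)
    exact congrArg ENNReal.toReal ((measurePreserving_eval
      (fun _ : Fin L ↦ uniformOn (Set.univ : Set (Fin (T + 1)))) ⟨l, hl⟩).measure_preimage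
        (Set.toFinite {a : Fin (T + 1) | e ∈ S (a + 1) ∧ e ∉ S a}).measurableSet.nullMeasurableSet)

/-- The offline outcomes for which an element lies in a difference of consecutive sets of the chain
in which it is spanned with probability little more than `1/2`. -/
def goodChain (M : Matroid (Fin n)) (δ : ℝ) (L T m k : ℕ) (x : Fin n → unitInterval) (e : Fin n) :
    Set ((Fin L → Fin (T + 1)) × (Fin k → Fin n → Bool)) :=
  {p | ∃ l < L, e ∈ chain M δ T m p.1 p.2 l ∧ e ∉ chain M δ T m p.1 p.2 (l + 1) ∧
    (thinLaw x).real (spanEvent M (chain M δ T m p.1 p.2 l) (chain M δ T m p.1 p.2 (l + 1)) e) ≤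
      1 / 2 + 3 * δ}

lemma offlineLaw_goodChain_ge (hE : M.E = Set.univ)
    (hx : (fun i ↦ (x i : ℝ)) ∈ polytope {I | M.Indep I}) (hδ : 0 < δ) (hm : 0 < m)
    (hL : n < (1 + 2 * δ) ^ L) {e : Fin n} (he : 0 < x e) :
    1 - (L * (T + 1) * n * (2 * Real.exp (-(2 * δ ^ 2 * m))) + L * (1 / (T + 1))) ≤
      (offlineLaw L T (L * (T + 1) * m) x).real (goodChain M δ L T m _ x e) := by
  have hP : IsProbabilityMeasure (offlineLaw L T (L * (T + 1) * m) x) := inferInstance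
  revert hP
  generalize hPdef : offlineLaw L T (L * (T + 1) * m) x = P
  intro hP
  set bad : Fin L × Fin (T + 1) × Fin n → Set _ := fun q ↦
    inaccurate M δ L T m (L * (T + 1) * m) x q.1 q.2.1 q.2.2
  set lateAt : Fin L → Set _ := fun l ↦ late M δ L T m (L * (T + 1) * m) l e
  have hsub : (goodChain M δ L T m _ x e)ᶜ ⊆ (⋃ q, bad q) ∪ ⋃ l, lateAt l := by
    intro p hp
    by_contra hcon
    simp only [Set.mem_union, Set.mem_iUnion, not_or, not_exists] at hcon
    refine hp (exists_level_of_accurate hE hx hδ hL he (fun l hl r hr f ↦ ?_) fun l hl ↦ ?_)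
    · exact not_le.1 (hcon.1 (⟨l, hl⟩, ⟨r, Nat.lt_succ_of_le hr⟩, f))
    · exact hcon.2 ⟨l, hl⟩
  have h1 : P.real (⋃ q, bad q) ≤ L * (T + 1) * n * (2 * Real.exp (-(2 * δ ^ 2 * m))) := by
    refine (measureReal_iUnion_fintype_le _).trans ((Finset.sum_le_card_nsmul _ _ _ fun q _ ↦
      hPdef ▸ offlineLaw_inaccurate_le hδ hm q.1.2 (Nat.le_of_lt_succ q.2.1.2) q.2.2).trans ?_)
    simp [mul_assoc]
  have h2 : P.real (⋃ l, lateAt l) ≤ L * (1 / (T + 1)) := by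
    refine (measureReal_iUnion_fintype_le _).trans ((Finset.sum_le_card_nsmul _ _ _ fun l _ ↦
      hPdef ▸ offlineLaw_late_le _ l.2 e).trans ?_)
    simp
  have h3 := (measureReal_mono hsub).trans ((measureReal_union_le _ _).trans (add_le_add h1 h2))
  rw [probReal_compl_eq_one_sub .of_discrete] at h3
  linarith

end Estimates

/-! ### Selectability. -/

lemma Scheme.law_active {F : Set (Set (Fin n))} {k : ℕ} (A : Scheme F k)
    (x : Fin n → unitInterval) (i : Fin n) : A.law x (A.active i) = ENNReal.ofReal (x i) := by
  have : A.active i = Set.univ ×ˢ (Set.univ ×ˢ ((fun R : Fin n → Bool ↦ R i) ⁻¹' {true})) := by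
    ext o; simp [Scheme.active]
  rw [this, Scheme.law, Measure.prod_prod, Measure.prod_prod, measure_univ, measure_univ, one_mul,
    one_mul, activeLaw, (measurePreserving_eval _ i).measure_preimage
      (Set.toFinite {true}).measurableSet.nullMeasurableSet, bernoulli_true]

lemma Scheme.le_cond_accepted {F : Set (Set (Fin n))} {k : ℕ} (A : Scheme F k)
    {x : Fin n → unitInterval} {i : Fin n} (hx : 0 < x i) {σ : A.Outcome → Equiv.Perm (Fin n)}
    {E : Set A.Outcome} (hE : E ⊆ A.active i ∩ A.accepted σ i) {c : ℝ}
    (hc : c * x i ≤ (A.law x).real E) :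
    c ≤ (cond (A.law x) (A.active i)).real (A.accepted σ i) := by
  have hprob : IsProbabilityMeasure (A.law x) := by unfold Scheme.law; infer_instance
  have heval : Measurable fun o : A.Outcome ↦ o.2.2 i := measurable_snd.snd.eval
  have hmeas : MeasurableSet (A.active i) := heval (MeasurableSet.singleton true)
  have hx' : (0 : ℝ) < x i := by exact_mod_cast hx
  rw [Measure.real, cond_apply hmeas, ENNReal.toReal_mul, A.law_active, ENNReal.toReal_inv,
    ENNReal.toReal_ofReal hx'.le, inv_mul_eq_div, le_div_iff₀ hx']
  exact hc.trans (measureReal_mono hE)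

lemma chainScheme_isSelectable {M : Matroid (Fin n)} (hE : M.E = Set.univ) {δ : ℝ} {L T m : ℕ}
    (hδ : 0 < δ) (hδ' : 6 * δ ≤ 1) (hm : 0 < m) (hL : n < (1 + 2 * δ) ^ L)
    (hfail : L * (T + 1) * n * (2 * Real.exp (-(2 * δ ^ 2 * m))) + L * (1 / (T + 1)) ≤ δ) :
    (chainScheme M hE δ L T m).IsSelectable ((1 - δ) * (1 / 2 * (1 / 2 - 3 * δ))) := by
  intro x hx σ _ e he
  -- The event `E` below does not mention the order `σ`, yet forces acceptance of `e`.
  set good := goodChain M δ L T m (L * (T + 1) * m) x e with hgood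
  set E : Set (((Fin L → Fin (T + 1)) × (Fin (L * (T + 1) * m) → Fin n → Bool)) ×
      ((Fin n → Bool) × (Fin n → Bool))) := {o | o.2.1 e = true ∧ o.2.2 e = true ∧
    ∃ l < L, e ∈ chain M δ T m o.1.1 o.1.2 l ∧ e ∉ chain M δ T m o.1.1 o.1.2 (l + 1) ∧
      o.2 ∉ spanEvent M (chain M δ T m o.1.1 o.1.2 l) (chain M δ T m o.1.1 o.1.2 (l + 1)) e}
    with hEdef
  have hxe : (0 : ℝ) < x e := by exact_mod_cast he
  refine (chainScheme M hE δ L T m).le_cond_accepted he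
    (E := Equiv.prodProdProdComm _ _ _ _ ⁻¹' E) ?_ ?_
  · rintro ⟨⟨t, mask⟩, ω, R⟩ ⟨hm, hR, l, hl, h1, h2, h3⟩
    exact ⟨hR, mem_output_chainAccept hl h1 h2 hm hR h3 _⟩
  · have hpres : ((chainScheme M hE δ L T m).law x).real
        (Equiv.prodProdProdComm _ _ _ _ ⁻¹' E) =
        ((offlineLaw L T (L * (T + 1) * m) x).prod (thinLaw x)).real E :=
      congrArg ENNReal.toReal ((measurePreserving_prodProdProdComm (timeLaw L T)
        (activeLaw (half n)) (Measure.pi fun _ : Fin (L * (T + 1) * m) ↦ activeLaw x)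
        (activeLaw x)).measure_preimage (Set.toFinite E).measurableSet.nullMeasurableSet)
    rw [hpres]
    refine le_trans ?_ (le_prod_real (G := good) (c := 1 / 2 * x e * (1 / 2 - 3 * δ)) ?_)
    · have h1 : 1 - δ ≤ (offlineLaw L T (L * (T + 1) * m) x).real good :=
        le_trans (by linarith) (offlineLaw_goodChain_ge hE hx hδ hm hL he)
      have h2 : 0 ≤ 1 / 2 * x e * (1 / 2 - 3 * δ) :=
        mul_nonneg (by positivity) (by linarith)
      calc _ = (1 - δ) * (1 / 2 * x e * (1 / 2 - 3 * δ)) := by ring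
        _ ≤ _ := mul_le_mul_of_nonneg_right h1 h2
    · rintro ⟨t, ω⟩ ⟨l, hl, h1, h2, h3⟩
      have hcoord := thinLaw_coordinate x e
        (spanEvent M (chain M δ T m t ω l) (chain M δ T m t ω (l + 1)) e)ᶜ (by
          intro p p' h hp hp'
          refine hp (M.closure_subset_closure ?_ hp')
          rintro f ⟨hf | ⟨hf, hfC⟩, hfe⟩
          · exact ⟨Or.inl hf, hfe⟩
          · obtain ⟨h4, h5⟩ := h f hfe
            exact ⟨Or.inr ⟨⟨h4.trans hf.1, h5.trans hf.2⟩, hfC⟩, hfe⟩)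
      rw [probReal_compl_eq_one_sub .of_discrete] at hcoord
      calc 1 / 2 * x e * (1 / 2 - 3 * δ)
          ≤ 1 / 2 * x e * (1 - (thinLaw x).real
              (spanEvent M (chain M δ T m t ω l) (chain M δ T m t ω (l + 1)) e)) :=
            mul_le_mul_of_nonneg_left (by linarith) (by positivity)
        _ ≤ _ := by
          rw [← hcoord]
          exact measureReal_mono fun p hp ↦ ⟨hp.1, hp.2.1, l, hl, h1, h2, hp.2.2⟩

/-- On at most one element, the scheme that accepts each active non-loop. -/
lemma exists_isSelectable_of_subsingleton [Subsingleton (Fin n)] (M : Matroid (Fin n)) {c : ℝ}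
    (hc : c ≤ 1) : ∃ A : Scheme {I | M.Indep I} 0, A.IsSelectable c := by
  classical
  let A : Scheme {I | M.Indep I} 0 :=
    { Seed := Unit
      seedSpace := inferInstance
      seedLaw := Measure.dirac ()
      seedLaw_isProbabilityMeasure := inferInstance
      accept _ _ _ e := decide (M.Indep {e})
      measurable_accept _ _ _ := .of_discrete
      feasible _ _ σ R := by
        generalize ho : output (fun _ e ↦ decide (M.Indep {e})) σ R = O
        rcases (Set.subsingleton_of_subsingleton (s := O)).eq_empty_or_singleton with rfl | ⟨e, rfl⟩
        · exact M.empty_indep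
        · have he : e ∈ output (fun _ e ↦ decide (M.Indep {e})) σ R := ho ▸ rfl
          exact of_decide_eq_true he.2 }
  refine ⟨A, fun x hx σ _ i hi ↦ ?_⟩
  have hxi : (0 : ℝ) < x i := by exact_mod_cast hi
  have hind : M.Indep {i} := by
    have h1 := sum_le_rank_of_mem_polytope hx {i}
    simp only [Finset.sum_singleton, Finset.coe_singleton] at h1
    have h2 : M.eRk {i} ≠ 0 := fun h ↦ by
      simp only [rank, h] at h1
      simp at h1
      linarith
    rw [Matroid.indep_singleton, ← Matroid.eRk_singleton_eq_one_iff]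
    exact le_antisymm (M.eRk_singleton_le i) (Order.one_le_iff_ne_zero.2 h2)
  refine A.le_cond_accepted hi (E := A.active i) (fun o ho ↦ ⟨ho, ho, ?_⟩) ?_
  · simpa [A] using hind
  · rw [Measure.real, A.law_active, ENNReal.toReal_ofReal hxi.le]
    exact mul_le_of_le_one_left hxi.le hc

lemma Scheme.IsSelectable.mono {n : ℕ} {F : Set (Set (Fin n))} {k : ℕ} {A : Scheme F k} {c c' : ℝ}
    (h : A.IsSelectable c) (hc : c' ≤ c) : A.IsSelectable c' :=
  fun x hx σ hσ i hi ↦ hc.trans (h x hx σ hσ i hi)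

/-! ### Choice of parameters and conclusion. -/

/-- Numbers of levels, rounds and samples per round, each logarithmic in `n`, for which the chain
is good with probability at least `1 - δ`. -/
lemma exists_parameters {δ : ℝ} (hδ : 0 < δ) : ∃ C : ℝ, ∀ n : ℕ, 2 ≤ n → ∃ L T m : ℕ,
    0 < m ∧ (n : ℝ) < (1 + 2 * δ) ^ L ∧
    L * (T + 1) * n * (2 * Real.exp (-(2 * δ ^ 2 * m))) + L * (1 / (T + 1)) ≤ δ ∧
    ((L * (T + 1) * m : ℕ) : ℝ) ≤ C * Real.log n ^ 4 := by
  set a := Real.log (1 + 2 * δ) with ha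
  set b := Real.log 2 with hb
  have ha0 : 0 < a := Real.log_pos (by linarith)
  have hb0 : 0 < b := Real.log_pos (by norm_num)
  set c₁ := 1 / a + 1 / b with hc₁
  set c₂ := 2 * c₁ / δ + 2 / b with hc₂
  -- Chosen so that the union bound over inaccurate estimates is at most `δ / 2`; the other half
  -- pays for the stopping times.
  set K := 4 * c₁ * c₂ / δ with hK
  set c₃ := (3 + K / b) / (2 * δ ^ 2) + 1 / b with hc₃
  have hc₁0 : 0 < c₁ := by positivity
  have hc₂0 : 0 < c₂ := by positivity
  have hK0 : 0 < K := by positivity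
  have hc₃0 : 0 < c₃ := by positivity
  refine ⟨c₁ * c₂ * c₃ / b, fun n hn ↦ ?_⟩
  have hn' : (2 : ℝ) ≤ n := by exact_mod_cast hn
  have hn0 : (0 : ℝ) < n := by linarith
  set l := Real.log n with hl
  have hbl : b ≤ l := Real.log_le_log (by norm_num) hn'
  have hl0 : 0 < l := hb0.trans_le hbl
  have hln : l ≤ n := (Real.log_le_sub_one_of_pos hn0).trans (by linarith)
  -- This absorbs additive constants into multiples of `log n`.
  have hone : 1 ≤ 1 / b * l := by rw [one_div, inv_mul_eq_div, one_le_div hb0]; exact hbl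
  set L := ⌊l / a⌋₊ + 1 with hL
  set T := ⌈2 * (L : ℝ) / δ⌉₊ with hT
  set m := ⌊(3 * l + K) / (2 * δ ^ 2)⌋₊ + 1 with hm
  have hL1 : (L : ℝ) ≤ c₁ * l := by
    have : (⌊l / a⌋₊ : ℝ) ≤ l / a := Nat.floor_le (by positivity)
    rw [hL, hc₁, add_mul, one_div_mul_eq_div]
    push_cast
    linarith
  have hL2 : (n : ℝ) < (1 + 2 * δ) ^ L := by
    have h1 : l / a < L := by rw [hL]; push_cast; exact Nat.lt_floor_add_one _
    rw [div_lt_iff₀ ha0] at h1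
    rw [← Real.log_lt_log_iff hn0 (by positivity), Real.log_pow]
    exact h1
  have hL0 : (0 : ℝ) < L := by rw [hL]; positivity
  have hT1 : (T : ℝ) + 1 ≤ c₂ * l := by
    have h1 : (T : ℝ) < 2 * L / δ + 1 := Nat.ceil_lt_add_one (by positivity)
    have h2 : 2 * (L : ℝ) / δ ≤ 2 * (c₁ * l) / δ := by gcongr
    have h3 : c₂ * l = 2 * (c₁ * l) / δ + 2 * (1 / b * l) := by rw [hc₂]; ring
    linarith
  have hT2 : L * (1 / ((T : ℝ) + 1)) ≤ δ / 2 := by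
    have h1 : 2 * (L : ℝ) / δ ≤ T := Nat.le_ceil _
    rw [div_le_iff₀ hδ] at h1
    rw [mul_one_div, div_le_iff₀ (by positivity)]
    nlinarith
  have hm1 : (m : ℝ) ≤ c₃ * l := by
    have h1 : (⌊(3 * l + K) / (2 * δ ^ 2)⌋₊ : ℝ) ≤ (3 * l + K) / (2 * δ ^ 2) :=
      Nat.floor_le (by positivity)
    have h2 : (3 * l + K) / (2 * δ ^ 2) ≤ (3 * l + K * (1 / b * l)) / (2 * δ ^ 2) := by
      gcongr
      exact le_mul_of_one_le_right hK0.le hone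
    have h3 : c₃ * l = (3 * l + K * (1 / b * l)) / (2 * δ ^ 2) + 1 / b * l := by rw [hc₃]; ring
    rw [h3, hm]
    push_cast
    linarith
  have hm2 : Real.exp (-(2 * δ ^ 2 * m)) ≤ 1 / (n ^ 3 * K) := by
    have h1 : (3 * l + K) / (2 * δ ^ 2) < m := by rw [hm]; push_cast; exact Nat.lt_floor_add_one _
    rw [div_lt_iff₀ (by positivity)] at h1
    have h2 : (n : ℝ) ^ 3 * K ≤ Real.exp (2 * δ ^ 2 * m) := by
      calc (n : ℝ) ^ 3 * K ≤ n ^ 3 * Real.exp K := by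
            gcongr
            linarith [Real.add_one_le_exp K]
        _ = Real.exp (3 * l + K) := by
            rw [Real.exp_add, ← Real.exp_log hn0, ← hl, ← Real.exp_nat_mul]
            norm_num
        _ ≤ _ := Real.exp_le_exp.2 (by linarith)
    rw [Real.exp_neg, ← one_div]
    exact one_div_le_one_div_of_le (by positivity) h2
  refine ⟨L, T, m, by omega, hL2, ?_, ?_⟩
  · have h1 : (L : ℝ) * (T + 1) ≤ c₁ * c₂ * n ^ 2 := by
      calc (L : ℝ) * (T + 1) ≤ (c₁ * l) * (c₂ * l) := by gcongr
        _ = c₁ * c₂ * l ^ 2 := by ring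
        _ ≤ _ := by gcongr
    have h2 : (L : ℝ) * (T + 1) * n * (2 * Real.exp (-(2 * δ ^ 2 * m))) ≤ δ / 2 := by
      calc (L : ℝ) * (T + 1) * n * (2 * Real.exp (-(2 * δ ^ 2 * m)))
          ≤ c₁ * c₂ * n ^ 2 * n * (2 * (1 / (n ^ 3 * K))) := by gcongr
        _ = δ / 2 := by
          rw [hK]
          field_simp
          norm_num
    linarith
  · push_cast
    calc (L : ℝ) * (T + 1) * m ≤ (c₁ * l) * (c₂ * l) * (c₃ * l) := by gcongr
      _ = c₁ * c₂ * c₃ * l ^ 3 * 1 := by ring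
      -- The count is in fact cubic in `log n`; a factor is given away to match the stated power.
      _ ≤ c₁ * c₂ * c₃ * l ^ 3 * (1 / b * l) := by gcongr
      _ = _ := by ring

end OCRS

end

theorem theorem2 (ε : ℝ) (hε : 0 < ε) :
    ∃ C : ℝ, ∀ n : ℕ, ∃ k : ℕ, (k : ℝ) ≤ C * Real.log n ^ 4 ∧
      ∀ M : Matroid (Fin n), M.E = Set.univ →
        ∃ A : OCRS.Scheme {I | M.Indep I} k, A.IsSelectable (1 / 4 - ε) := by
  -- `(1 - δ)(1/4 - 3δ/2) ≥ 1/4 - 2δ ≥ 1/4 - ε`, and `1/8` ensures `6δ ≤ 1`.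
  set δ := min (ε / 2) (1 / 8) with hδ
  have hδ0 : 0 < δ := by positivity
  have hδε : δ ≤ ε / 2 := min_le_left _ _
  have hδ8 : δ ≤ 1 / 8 := min_le_right _ _
  obtain ⟨C, hC⟩ := OCRS.exists_parameters hδ0
  refine ⟨C, fun n ↦ ?_⟩
  -- For `n ≤ 1` the logarithm is `0` (by convention at `n = 0`), so no samples are allowed.
  rcases lt_or_ge n 2 with hn | hn
  · have : Subsingleton (Fin n) := Fin.subsingleton_iff_le_one.2 (by omega)
    refine ⟨0, ?_, fun M _ ↦ OCRS.exists_isSelectable_of_subsingleton M (by linarith)⟩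
    interval_cases n <;> simp
  · obtain ⟨L, T, m, hm, hL, hfail, hk⟩ := hC n hn
    refine ⟨_, hk, fun M hE ↦ ⟨OCRS.chainScheme M hE δ L T m, ?_⟩⟩
    exact (OCRS.chainScheme_isSelectable hE hδ0 (by linarith) hm hL hfail).mono (by nlinarith)
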